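/- Let $K$ be an algebraically closed field and let $V$ be an irreducible normal variety over $K$, that is, an integral normal separated scheme of finite type over $K$. Assume that $V$ is (algebraically) simply connected: it is connected, and every finite étale morphism $W\to V$ with $W$ connected (and non-empty) is an isomorphism. Assume moreover that $K$ has characteristic $0$ or that the (Weil) divisor class group of $V$ is trivial. Then every invertible regular function on $V$ is constant: for every unit $f\in\Gamma(V,\mathcal O_V)^{\times}$, $f$ is the image of some $c\in K$ under the structure map $K\to\Gamma(V,\mathcal O_V)$. -/

import Mathlib

open CategoryTheory AlgebraicGeometry

universe u

namespace AlgVar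

/-- A scheme is normal if all its local rings are integrally closed domains. -/
def IsNormal (X : Scheme.{u}) : Prop :=
  ∀ x : X, IsDomain (X.presheaf.stalk x) ∧ IsIntegrallyClosed (X.presheaf.stalk x)

/-- A scheme is (algebraically) simply connected if it is connected and has no nontrivial
connected finite étale covering: every finite étale morphism to it from a connected
(in particular nonempty) scheme is an isomorphism. -/
structure IsSimplyConnected (X : Scheme.{u}) : Prop where
  connected : ConnectedSpace X
  isIso_of_finite_etale : ∀ (W : Scheme.{u}) (φ : W ⟶ X),
    ConnectedSpace W → IsFinite φ → Etale φ → IsIso φ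

/-- Prime divisors of `X`, i.e. integral closed subschemes of codimension one, represented by
their generic points. -/
abbrev PrimeDivisor (X : Scheme.{u}) : Type u :=
  {x : X // Order.coheight x = 1}

/-- Weil divisors: finite formal integral combinations of prime divisors. -/
abbrev WeilDivisor (X : Scheme.{u}) : Type u :=
  PrimeDivisor X →₀ ℤ

section ClassGroup

variable (X : Scheme.{u}) [IsIntegral X] [IsLocallyNoetherian X]

lemma ord_one (x : X) : Scheme.ord (1 : X.functionField) x = 0 := by
  have h := Scheme.ord_mul (x := x) (one_ne_zero (α := X.functionField)) one_ne_zero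
  rw [one_mul] at h
  omega

lemma ord_inv {f : X.functionField} (hf : f ≠ 0) (x : X) :
    Scheme.ord f⁻¹ x = -Scheme.ord f x := by
  have h := Scheme.ord_mul (x := x) hf (inv_ne_zero hf)
  rw [mul_inv_cancel₀ hf, ord_one] at h
  omega

/-- The subgroup of principal divisors: the divisors `∑ ord_x(f) · x` of nonzero rational
functions `f`. -/
noncomputable def principalDivisors : AddSubgroup (WeilDivisor X) where
  carrier := {D | ∃ f : X.functionField, f ≠ 0 ∧ ∀ x : PrimeDivisor X, D x = Scheme.ord f x.1}
  zero_mem' := ⟨1, one_ne_zero, fun x => by rw [ord_one]; rfl⟩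
  add_mem' := by
    rintro D E ⟨f, hf, hD⟩ ⟨g, hg, hE⟩
    exact ⟨f * g, mul_ne_zero hf hg, fun x => by
      rw [Scheme.ord_mul hf hg, Finsupp.add_apply, hD, hE]⟩
  neg_mem' := by
    rintro D ⟨f, hf, hD⟩
    exact ⟨f⁻¹, inv_ne_zero hf, fun x => by rw [ord_inv X hf, Finsupp.neg_apply, hD]⟩

/-- The divisor class group: Weil divisors modulo principal divisors. -/
abbrev DivisorClassGroup : Type u :=
  WeilDivisor X ⧸ principalDivisors X

end ClassGroup

/-- A scheme locally of finite type over a field is locally Noetherian. -/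
lemma isLocallyNoetherian_of_field {K : Type u} [Field K] {V : Scheme.{u}}
    (p : V ⟶ Spec (.of K)) [LocallyOfFiniteType p] : IsLocallyNoetherian V :=
  LocallyOfFiniteType.isLocallyNoetherian p

/-- The constant regular function on the `K`-scheme `p : V ⟶ Spec K` with value `c`. -/
noncomputable def constFun {K : Type u} [Field K] {V : Scheme.{u}}
    (p : V ⟶ Spec (.of K)) (c : K) : Γ(V, ⊤) :=
  p.appTop ((Scheme.ΓSpecIso (.of K)).inv c)

end AlgVar

/-!
Let `l` be a prime different from the characteristic of `K` and let `f` be an invertible function on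
`V`. The Kummer covering `W` of `V` that adjoins an `l`-th root of `f` is finite étale, because
`X ^ l - f` is separable over `Γ(V, ⊤)`.

If `f` is not an `l`-th power in the function field `k(V)`, then `X ^ l - f` is irreducible over
`k(V)`, so the generic fibre of `W ⟶ V` is a single point. As `W ⟶ V` is open, `W` is irreducible,
in particular connected, so `W ⟶ V` is an isomorphism. Its inverse is a section of `W ⟶ V`, that is,
an `l`-th root of `f` in `Γ(V, ⊤)`, a contradiction. So `f` is an `l`-th power in `k(V)`, and by
normality already in `Γ(V, ⊤)` (`AlgVar.IsSimplyConnected.exists_pow_eq`). This applies again to the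
root, which is invertible as well; hence `f` has an `l ^ m`-th root for every `m`.

The field `k(V)` is finitely generated over `K`. In such a field an element with roots of
arbitrarily large order is algebraic over `K` (`isAlgebraic_of_forall_exists_pow_eq`), and
`K` is algebraically closed, so `f` lies in `K`.
-/

/-! ### Infinitely divisible elements of finitely generated fields -/

/-- In a finitely generated field extension `F / K`, an element with roots of unboundedly large
order is algebraic. If `x` were transcendental, it would belong to a transcendence basis `B`, and
with `E = K(B \ {x})` the field `F` would be finite over `E(x)`, a rational function field. The norm
of an `n`-th root of `x` down to `E(x)` is then an `n`-th root of `x ^ [F : E(x)]`, so that comparing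
degrees in `x` gives `n ∣ [F : E(x)]`. -/
theorem isAlgebraic_of_forall_exists_pow_eq {K F : Type*} [Field K] [Field F] [Algebra K F]
    [Algebra.EssFiniteType K F] {x : F} (h : ∀ N : ℕ, ∃ n > N, ∃ g : F, g ^ n = x) :
    IsAlgebraic K x := by
  by_contra hx
  replace hx : Transcendental K x := hx
  have hind : AlgebraicIndepOn K id {x} := by
    have := (algebraicIndependent_unique_type_iff (R := K) (ι := ({x} : Set F))
      (x := fun i => (i : F))).2 (by simpa using hx)
    exact this
  obtain ⟨B, hxB, hB⟩ := exists_isTranscendenceBasis_superset hind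
  rw [Set.singleton_subset_iff] at hxB
  let E := IntermediateField.adjoin K (B \ {x})
  have hxE : Transcendental E x := by
    have h1 : AlgebraicIndepOn K id (insert x (B \ {x})) := by
      rw [Set.insert_sdiff_singleton, Set.insert_eq_of_mem hxB]
      exact hB.1
    have h2 := ((AlgebraicIndepOn.insert_iff (by simp)).1 h1).2
    rw [Set.image_id] at h2
    intro h3
    apply h2
    open scoped IntermediateField.algebraAdjoinAdjoin in
    exact (IsFractionRing.isAlgebraic_iff (Algebra.adjoin K (B \ {x})) E F).2 h3
  let e := RatFunc.algEquivOfTranscendental x hxE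
  let L := IntermediateField.adjoin E {x}
  -- `F` is algebraic over `L = E(x)`, because `L` contains the whole transcendence basis.
  have hle : IntermediateField.adjoin K (Set.range ((↑) : B → F)) ≤ L.restrictScalars K := by
    rw [IntermediateField.adjoin_le_iff]
    rintro _ ⟨⟨b, hb⟩, rfl⟩
    by_cases hbx : b = x
    · subst hbx
      exact IntermediateField.mem_adjoin_simple_self E b
    · exact L.algebraMap_mem ⟨b, IntermediateField.subset_adjoin K _ ⟨hb, hbx⟩⟩
  have halg : Algebra.IsAlgebraic L F := by
    have := hB.isAlgebraic_field
    refine ⟨fun y => ?_⟩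
    have hy := Algebra.IsAlgebraic.isAlgebraic
      (R := IntermediateField.adjoin K (Set.range ((↑) : B → F))) y
    exact hy.tower_top_of_subalgebra_le (A := (IntermediateField.adjoin K _).toSubalgebra)
      (B := (L.restrictScalars K).toSubalgebra) hle
  have : IsScalarTower K L F := .of_algebraMap_eq fun _ => rfl
  have : Algebra.EssFiniteType L F := Algebra.EssFiniteType.of_comp K L F
  have : Module.Finite L F := Algebra.finite_of_essFiniteType_of_isAlgebraic
  obtain ⟨n, hn, g, hg⟩ := h (Module.finrank L F)
  have hd := Module.finrank_pos (R := L) (M := F)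
  have key : e.symm (Algebra.norm L g) ^ n = RatFunc.X ^ Module.finrank L F := by
    rw [← map_pow, ← map_pow, hg]
    have : Algebra.norm L x = IntermediateField.AdjoinSimple.gen E x ^ Module.finrank L F :=
      Algebra.norm_algebraMap (IntermediateField.AdjoinSimple.gen E x)
    rw [this, map_pow, RatFunc.algEquivOfTranscendental_symm_gen]
  have hdeg (r : RatFunc E) (hr : r ≠ 0) (m : ℕ) : (r ^ m).intDegree = m * r.intDegree := by
    induction m with
    | zero => simp
    | succ m ih => rw [pow_succ, RatFunc.intDegree_mul (pow_ne_zero _ hr) hr, ih]; push_cast; ring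
  have hr : e.symm (Algebra.norm L g) ≠ 0 := by
    rintro h0
    rw [h0, zero_pow (by omega)] at key
    exact pow_ne_zero _ RatFunc.X_ne_zero key.symm
  have := congrArg RatFunc.intDegree key
  rw [hdeg _ hr, hdeg _ RatFunc.X_ne_zero, RatFunc.intDegree_X, mul_one] at this
  have h4 : n ∣ Module.finrank L F := by exact_mod_cast Dvd.intro _ this
  exact absurd (Nat.le_of_dvd hd h4) (by omega)

/-! ### Regular functions on normal schemes -/

/-- A rational function that is regular at every point of `U` is a section over `U`. -/
theorem AlgebraicGeometry.Scheme.exists_germToFunctionField_eq {X : Scheme.{u}} [IsIntegral X]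
    {U : X.Opens} [Nonempty U] (g : X.functionField)
    (h : ∀ x : U, g ∈ (algebraMap (X.presheaf.stalk x.1) X.functionField).range) :
    ∃ b : Γ(X, U), X.germToFunctionField U b = g := by
  have h' (x : U) : ∃ (A : X.Opens) (_ : x.1 ∈ A) (_ : A ≤ U) (_ : Nonempty A) (s : Γ(X, A)),
      X.germToFunctionField A s = g := by
    obtain ⟨t, ht⟩ := h x
    obtain ⟨A, hxA, s, rfl⟩ := X.presheaf.exists_germ_eq t
    have : Nonempty A := ⟨⟨_, hxA⟩⟩
    have : Nonempty (A ⊓ U : X.Opens) := ⟨⟨_, hxA, x.2⟩⟩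
    refine ⟨A ⊓ U, ⟨hxA, x.2⟩, inf_le_right, this, X.presheaf.map (homOfLE inf_le_left).op s, ?_⟩
    rw [Scheme.algebraMap_germ_eq_germToFunctionField] at ht
    rw [← ht]
    exact X.presheaf.germ_res_apply _ _ _ _
  choose A hxA hAU hA s hs using h'
  obtain ⟨b, hb, -⟩ := X.sheaf.existsUnique_gluing' A U (fun x => homOfLE (hAU x))
    (fun x hx => TopologicalSpace.Opens.mem_iSup.2 ⟨⟨x, hx⟩, hxA ⟨x, hx⟩⟩) s (by
      intro x y
      have hne : Nonempty (A x ⊓ A y : X.Opens) := by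
        obtain ⟨z, hz⟩ := nonempty_preirreducible_inter (A x).isOpen (A y).isOpen
          ⟨_, hxA x⟩ ⟨_, hxA y⟩
        exact ⟨⟨z, hz⟩⟩
      apply X.germToFunctionField_injective (A x ⊓ A y)
      refine (X.presheaf.germ_res_apply _ _ _ _).trans
        (Eq.trans ?_ (X.presheaf.germ_res_apply _ _ _ _).symm)
      exact (hs x).trans (hs y).symm)
  refine ⟨b, ?_⟩
  obtain ⟨x⟩ := ‹Nonempty U›
  rw [← hs x, ← hb x]
  exact (X.presheaf.germ_res_apply _ _ _ _).symm

/-- On a normal integral scheme, a regular function with an `n`-th root in the function field has a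
regular `n`-th root. -/
theorem AlgVar.IsNormal.exists_pow_eq_of_functionField {X : Scheme.{u}} [IsIntegral X]
    (hX : AlgVar.IsNormal X) {U : X.Opens} [Nonempty U] {g : X.functionField} {n : ℕ} (hn : n ≠ 0)
    {a : Γ(X, U)} (hg : g ^ n = X.germToFunctionField U a) :
    ∃ b : Γ(X, U), b ^ n = a := by
  obtain ⟨b, hb⟩ := X.exists_germToFunctionField_eq (U := U) g (fun x => by
    have := (hX x.1).2
    refine (IsIntegrallyClosed.isIntegral_iff (R := X.presheaf.stalk x.1)).1
      (IsIntegral.of_pow (Nat.pos_of_ne_zero hn) ?_)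
    rw [hg, ← X.algebraMap_germ_eq_germToFunctionField x.2]
    exact isIntegral_algebraMap)
  exact ⟨b, X.germToFunctionField_injective U (by rw [map_pow, hb, hg])⟩

/-! ### Kummer coverings -/

section

open Polynomial Limits

/-- For separable `p` the derivative of `p` is already invertible in `R[X] / p`, so this ring is
standard étale with nothing inverted. -/
theorem AdjoinRoot.etale_of_separable {R : Type*} [CommRing R] {p : R[X]} (hp : p.Monic)
    (hs : p.Separable) : Algebra.Etale R (AdjoinRoot p) := by
  obtain ⟨a, b, hab⟩ := hs
  let P : StandardEtalePair R :=
    { f := p, monic_f := hp, g := 1, cond := ⟨b, a, 0, by rw [pow_zero, ← hab]; ring⟩ }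
  have : IsLocalization.Away (1 : AdjoinRoot p) (Localization.Away (AdjoinRoot.mk P.f P.g)) := by
    have : AdjoinRoot.mk P.f P.g = 1 := map_one _
    rw [this]; exact Localization.isLocalization
  let e : AdjoinRoot p ≃ₐ[AdjoinRoot p] Localization.Away (AdjoinRoot.mk P.f P.g) :=
    IsLocalization.atOne _ _
  exact Algebra.Etale.of_equiv (P.equivAwayAdjoinRoot.trans (e.restrictScalars R).symm)

/-- A scheme that is open over an irreducible scheme with at most one point in the generic fibre is
irreducible or empty, since every nonempty open subset meets the generic fibre. -/
theorem preirreducibleSpace_of_subsingleton_preimage_genericPoint {X Y : Scheme.{u}}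
    [IrreducibleSpace Y] (φ : X ⟶ Y) (hφ : IsOpenMap φ)
    (hs : (φ ⁻¹' {genericPoint Y}).Subsingleton) : PreirreducibleSpace X := by
  have key {A : Set X} (hA : IsOpen A) (h : A.Nonempty) : ∃ a ∈ A, φ a = genericPoint Y :=
    ((genericPoint_spec Y).mem_open_set_iff (hφ A hA)).2 (by simpa using h)
  refine ⟨fun A B hA hB ⟨a, _, ha⟩ ⟨b, _, hb⟩ => ?_⟩
  obtain ⟨a', ha', ha''⟩ := key hA ⟨a, ha⟩
  obtain ⟨b', hb', hb''⟩ := key hB ⟨b, hb⟩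
  obtain rfl := hs ha'' hb''
  exact ⟨a', trivial, ha', hb'⟩

open TensorProduct in
/-- The base change along `j : Spec k ⟶ X` of the pullback to `X` of `Spec S ⟶ Spec R` is
`Spec (k ⊗[R] S)`, so it has at most one point if the latter does. -/
theorem subsingleton_pullback_of_tensorProduct {R S k : Type u} [CommRing R] [CommRing S]
    [CommRing k] [Algebra R S] [Algebra R k] [Subsingleton (PrimeSpectrum (k ⊗[R] S))]
    {X : Scheme.{u}} (q : X ⟶ Spec (.of R)) (j : Spec (.of k) ⟶ X)
    (hj : j ≫ q = Spec.map (CommRingCat.ofHom (algebraMap R k))) :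
    Subsingleton ↥(pullback (pullback.fst q (Spec.map (CommRingCat.ofHom (algebraMap R S)))) j) := by
  let s := Spec.map (CommRingCat.ofHom (algebraMap R S))
  let e : pullback (pullback.fst q s) j ≅ Spec (.of (k ⊗[R] S)) :=
    pullbackSymmetry _ _ ≪≫ pullbackRightPullbackFstIso q s j ≪≫
      pullback.congrHom hj rfl ≪≫ pullbackSpecIso R k S
  have : Subsingleton ↥(Spec (.of (k ⊗[R] S))) := ‹Subsingleton (PrimeSpectrum (k ⊗[R] S))›
  exact e.hom.homeomorph.injective.subsingleton

open TensorProduct in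
/-- `k[X] / p` surjects onto `k ⊗[R] (R[X] / p)`, so the spectrum of the latter embeds in that of the
former. -/
theorem subsingleton_primeSpectrum_tensor_adjoinRoot {R k : Type*} [CommRing R] [CommRing k]
    [Algebra R k] {p : R[X]} [Subsingleton (PrimeSpectrum (AdjoinRoot (p.map (algebraMap R k))))] :
    Subsingleton (PrimeSpectrum (k ⊗[R] AdjoinRoot p)) := by
  let y : k ⊗[R] AdjoinRoot p := 1 ⊗ₜ AdjoinRoot.root p
  have hy : aeval y (p.map (algebraMap R k)) = 0 := by
    rw [aeval_map_algebraMap]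
    have : y = Algebra.TensorProduct.includeRight (R := R) (A := k) (AdjoinRoot.root p) := rfl
    rw [this, aeval_algHom_apply, AdjoinRoot.aeval_eq, AdjoinRoot.mk_self, map_zero]
  let φ : AdjoinRoot (p.map (algebraMap R k)) →ₐ[k] k ⊗[R] AdjoinRoot p :=
    AdjoinRoot.liftAlgHom _ (Algebra.ofId _ _) y hy
  have hφ : Function.Surjective φ := by
    intro t
    induction t with
    | zero => exact ⟨0, map_zero _⟩
    | add a b ha hb =>
      obtain ⟨a, rfl⟩ := ha
      obtain ⟨b, rfl⟩ := hb
      exact ⟨a + b, map_add _ _ _⟩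
    | tmul c z =>
      obtain ⟨r, rfl⟩ := AdjoinRoot.mk_surjective z
      refine ⟨c • AdjoinRoot.mk _ (r.map (algebraMap R k)), ?_⟩
      have h1 : φ (AdjoinRoot.mk _ (r.map (algebraMap R k))) = aeval y r := by
        rw [← aeval_map_algebraMap k]
        exact AdjoinRoot.liftAlgHom_mk _ _ _ hy (r.map (algebraMap R k))
      have h2 : aeval y r = 1 ⊗ₜ AdjoinRoot.mk p r := by
        have : y = Algebra.TensorProduct.includeRight (R := R) (A := k) (AdjoinRoot.root p) := rfl
        rw [this, aeval_algHom_apply, AdjoinRoot.aeval_eq]; rfl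
      rw [map_smul, h1, h2, TensorProduct.smul_tmul', smul_eq_mul, mul_one]
  exact (PrimeSpectrum.comap_injective_of_surjective φ.toRingHom hφ).subsingleton

/-- The assumption is `IsField` and not an instance `Field k` so that the lemma applies to the
ring structure of a stalk as it stands. -/
theorem IsField.subsingleton_primeSpectrum_adjoinRoot {k : Type*} [CommRing k] (hk : IsField k)
    {l : ℕ} (hl : l.Prime) {a : k} (ha : ∀ b, b ^ l ≠ a) :
    Subsingleton (PrimeSpectrum (AdjoinRoot (X ^ l - C a))) := by
  let _ := hk.toField
  have : Fact (Irreducible (X ^ l - C a)) := ⟨X_pow_sub_C_irreducible_of_prime hl ha⟩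
  exact inferInstanceAs (Subsingleton (PrimeSpectrum (AdjoinRoot (X ^ l - C a))))

theorem subsingleton_pullback_adjoinRoot {X : Scheme.{u}} {R k : CommRingCat.{u}}
    (q : X ⟶ Spec R) (j : Spec k ⟶ X) (γ : R ⟶ k) (hj : j ≫ q = Spec.map γ) (P : R[X])
    [hP : Subsingleton (PrimeSpectrum (AdjoinRoot (P.map γ.hom)))] :
    Subsingleton ↥(pullback (pullback.fst q
      (Spec.map (CommRingCat.ofHom (algebraMap R (AdjoinRoot P))))) j) := by
  let _ : Algebra R k := γ.hom.toAlgebra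
  have : Subsingleton (PrimeSpectrum (AdjoinRoot (P.map (algebraMap R k)))) := hP
  have := subsingleton_primeSpectrum_tensor_adjoinRoot (k := k) (p := P)
  exact subsingleton_pullback_of_tensorProduct (S := AdjoinRoot P) q j hj

/-- The points of `V ×[Spec Γ(V, ⊤)] Spec (Γ(V, ⊤)[X] / P)` over the generic point of `V` are those
of the spectrum of `k(V)[X] / P`; so there is at most one if this spectrum has at most one. -/
theorem AlgebraicGeometry.Scheme.subsingleton_preimage_genericPoint (V : Scheme.{u})
    [IsIntegral V] [Nonempty (⊤ : V.Opens)] (P : Γ(V, ⊤)[X])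
    [hP : Subsingleton (PrimeSpectrum (AdjoinRoot (P.map (V.germToFunctionField ⊤).hom)))] :
    (pullback.fst V.toSpecΓ (Spec.map (CommRingCat.ofHom
      (algebraMap Γ(V, ⊤) (AdjoinRoot P)))) ⁻¹' {genericPoint V}).Subsingleton := by
  have hsub := subsingleton_pullback_adjoinRoot V.toSpecΓ (V.fromSpecStalk (genericPoint V))
    (V.germToFunctionField ⊤) (V.fromSpecStalk_toSpecΓ _) P
  have hr := Scheme.Pullback.range_fst (pullback.fst V.toSpecΓ (Spec.map (CommRingCat.ofHom
      (algebraMap Γ(V, ⊤) (AdjoinRoot P))))) (V.fromSpecStalk (genericPoint V))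
  rw [Scheme.range_fromSpecStalk] at hr
  refine (Set.Subsingleton.anti ?_ (Set.preimage_mono (t := {y | y ⤳ genericPoint V}) ?_))
  · rw [← hr]
    exact Set.subsingleton_range _
  · rintro _ rfl
    exact specializes_rfl

/-- On a normal integral simply connected scheme, every invertible function has an `l`-th root for
each prime `l` that is invertible on the scheme: either `f` has a root in the function field, or the
Kummer covering defined by `X ^ l - f` is connected, hence trivial, hence has a section. -/
theorem AlgVar.IsSimplyConnected.exists_pow_eq {V : Scheme.{u}} [IsIntegral V]
    (hnormal : AlgVar.IsNormal V) (hsc : AlgVar.IsSimplyConnected V) {l : ℕ} (hl : l.Prime)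
    (hlu : IsUnit (l : Γ(V, ⊤))) {f : Γ(V, ⊤)} (hf : IsUnit f) : ∃ b, b ^ l = f := by
  have : Nonempty (⊤ : V.Opens) := ⟨⟨genericPoint V, trivial⟩⟩
  by_cases hirr : ∃ g : V.functionField, g ^ l = V.germToFunctionField ⊤ f
  · obtain ⟨g, hg⟩ := hirr
    exact hnormal.exists_pow_eq_of_functionField hl.ne_zero hg
  push Not at hirr
  let P : Γ(V, ⊤)[X] := X ^ l - C f
  have hPm : P.Monic := monic_X_pow_sub_C f hl.ne_zero
  have := AdjoinRoot.etale_of_separable hPm (separable_X_pow_sub_C_unit hf.unit hlu)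
  have : Module.Finite Γ(V, ⊤) (AdjoinRoot P) := hPm.finite_adjoinRoot
  let s : Spec (.of (AdjoinRoot P)) ⟶ Spec Γ(V, ⊤) :=
    Spec.map (CommRingCat.ofHom (algebraMap Γ(V, ⊤) (AdjoinRoot P)))
  have hsf : IsFinite s := by
    rw [IsFinite.SpecMap_iff, CommRingCat.hom_ofHom, RingHom.finite_algebraMap]
    infer_instance
  have hse : Etale s := by
    rw [HasRingHomProperty.Spec_iff (P := @Etale), CommRingCat.hom_ofHom, RingHom.etale_algebraMap]
    infer_instance
  have hss : Surjective s :=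
    ⟨PrimeSpectrum.comap_surjective_iff_injective_of_finite.2 <|
      AdjoinRoot.of.injective_of_degree_ne_zero <| by
        rw [degree_X_pow_sub_C hl.pos]; exact_mod_cast hl.ne_zero⟩
  -- The Kummer covering of `V`.
  let φ := pullback.fst V.toSpecΓ s
  have hpre : (φ ⁻¹' {genericPoint V}).Subsingleton := by
    refine V.subsingleton_preimage_genericPoint (hP := ?_) P
    rw [Polynomial.map_sub, Polynomial.map_pow, map_X, map_C]
    exact (isField_stalk_of_closure_mem_irreducibleComponents V _ (by
      simp [irreducibleComponents_eq_singleton])).subsingleton_primeSpectrum_adjoinRoot hl hirr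
  have hpi := preirreducibleSpace_of_subsingleton_preimage_genericPoint φ φ.isOpenMap hpre
  have : Nonempty ↥(pullback V.toSpecΓ s) := by
    have : Surjective φ := inferInstance
    obtain ⟨w, -⟩ := φ.surjective (genericPoint V)
    exact ⟨w⟩
  have : ConnectedSpace ↥(pullback V.toSpecΓ s) := ConnectedSpace.mk ‹_›
  have hiso := hsc.isIso_of_finite_etale _ φ this inferInstance inferInstance
  -- The inverse of the covering gives a section, and with it a root of `P` in `Γ(V, ⊤)`.
  let ψ : V ⟶ Spec (.of (AdjoinRoot P)) := inv φ ≫ pullback.snd _ _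
  have hψ : ψ ≫ s = V.toSpecΓ := by
    rw [Category.assoc, ← pullback.condition, IsIso.inv_hom_id_assoc]
  let h : CommRingCat.of (AdjoinRoot P) ⟶ Γ(V, ⊤) := (Scheme.ΓSpecIso _).inv ≫ ψ.appTop
  have hh : CommRingCat.ofHom (algebraMap Γ(V, ⊤) (AdjoinRoot P)) ≫ h = 𝟙 _ := by
    rw [Scheme.ΓSpecIso_inv_naturality_assoc, ← Scheme.Hom.comp_appTop, hψ,
      Scheme.toSpecΓ_appTop]
    exact (Scheme.ΓSpecIso Γ(V, ⊤)).inv_hom_id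
  refine ⟨h (AdjoinRoot.root P), ?_⟩
  have h1 : AdjoinRoot.root P ^ l = algebraMap _ _ f := by
    have := AdjoinRoot.mk_self (f := P)
    rw [map_sub, map_pow, AdjoinRoot.mk_X, sub_eq_zero] at this
    exact this
  rw [← map_pow, h1]
  exact ConcreteCategory.congr_hom hh f

end

/-! ### Constancy of invertible functions -/

/-- On an integral scheme locally of finite type over an algebraically closed field, a regular
function with roots of unboundedly large order is constant. -/
theorem AlgebraicGeometry.Scheme.exists_eq_constFun {K : Type u} [Field K] [IsAlgClosed K]
    {V : Scheme.{u}} (p : V ⟶ Spec (.of K)) [IsIntegral V] [LocallyOfFiniteType p]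
    {f : Γ(V, ⊤)} (h : ∀ N : ℕ, ∃ n > N, ∃ g, g ^ n = f) :
    ∃ c : K, f = AlgVar.constFun p c := by
  obtain ⟨_, ⟨U, hU, rfl⟩, hηU, -⟩ :=
    V.isBasis_affineOpens.exists_subset_of_mem_open (Set.mem_univ (genericPoint V)) isOpen_univ
  have : Nonempty U := ⟨⟨_, hηU⟩⟩
  have : Nonempty (⊤ : V.Opens) := ⟨⟨genericPoint V, trivial⟩⟩
  let r : Γ(V, ⊤) ⟶ Γ(V, U) := V.presheaf.map (homOfLE le_top).op
  let ι : K →+* Γ(V, U) := r.hom.comp (p.appTop.hom.comp (Scheme.ΓSpecIso (.of K)).inv.hom)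
  have hι : ι.FiniteType := by
    have h1 := p.finiteType_appLE (isAffineOpen_top _) hU le_top
    have h2 := h1.comp (RingHom.FiniteType.of_surjective (Scheme.ΓSpecIso (.of K)).inv.hom
      (ConcreteCategory.bijective_of_isIso (Scheme.ΓSpecIso (.of K)).inv).surjective)
    exact h2
  let _ : Algebra K Γ(V, U) := ι.toAlgebra
  have : Algebra.FiniteType K Γ(V, U) := hι
  let _ : Algebra K V.functionField := ((V.germToFunctionField U).hom.comp ι).toAlgebra
  have : IsScalarTower K Γ(V, U) V.functionField := .of_algebraMap_eq fun _ => rfl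
  have := functionField_isFractionRing_of_isAffineOpen V U hU
  have : Algebra.EssFiniteType Γ(V, U) V.functionField :=
    .of_isLocalization _ (nonZeroDivisors Γ(V, U))
  have : Algebra.EssFiniteType K V.functionField := .comp K Γ(V, U) _
  have halg : IsAlgebraic K (V.germToFunctionField ⊤ f) := by
    refine isAlgebraic_of_forall_exists_pow_eq fun N => ?_
    obtain ⟨n, hn, g, rfl⟩ := h N
    exact ⟨n, hn, V.germToFunctionField ⊤ g, (map_pow _ _ _).symm⟩
  obtain ⟨c, hc⟩ := minpoly.mem_range_of_degree_eq_one K _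
    (IsAlgClosed.degree_eq_one_of_irreducible K (minpoly.irreducible halg.isIntegral))
  refine ⟨c, V.germToFunctionField_injective ⊤ ?_⟩
  rw [← hc]
  exact V.presheaf.germ_res_apply (homOfLE le_top) (genericPoint V) hηU _

theorem theorem3 {K : Type u} [Field K] [IsAlgClosed K]
    (V : Scheme.{u}) (p : V ⟶ Spec (.of K))
    [IsIntegral V] [IsSeparated p] [LocallyOfFiniteType p] [QuasiCompact p]
    (hnormal : AlgVar.IsNormal V) (hsc : AlgVar.IsSimplyConnected V)
    (h : CharZero K ∨
      haveI : IsLocallyNoetherian V := AlgVar.isLocallyNoetherian_of_field p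
      Subsingleton (AlgVar.DivisorClassGroup V))
    (f : Γ(V, ⊤)) (hf : IsUnit f) :
    ∃ c : K, f = AlgVar.constFun p c := by
  -- `2` and `3` do not both vanish in `K`.
  obtain ⟨l, hl, hlK⟩ : ∃ l : ℕ, l.Prime ∧ (l : K) ≠ 0 := by
    by_cases h2 : ((2 : ℕ) : K) = 0
    · refine ⟨3, Nat.prime_three, fun h3 => one_ne_zero (α := K) ?_⟩
      push_cast at h2 h3
      linear_combination h3 - h2
    · exact ⟨2, Nat.prime_two, h2⟩
  have hlu : IsUnit (l : Γ(V, ⊤)) := by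
    simpa using (IsUnit.mk0 _ hlK).map (p.appTop.hom.comp (Scheme.ΓSpecIso (.of K)).inv.hom)
  have hpow (m : ℕ) : ∃ g, g ^ l ^ m = f := by
    induction m with
    | zero => exact ⟨f, by simp⟩
    | succ m ih =>
      obtain ⟨g, hg⟩ := ih
      have hgu : IsUnit g := (isUnit_pow_iff (pow_ne_zero m hl.ne_zero)).1 (hg ▸ hf)
      obtain ⟨b, rfl⟩ := hsc.exists_pow_eq hnormal hl hlu hgu
      exact ⟨b, by rw [pow_succ', pow_mul, hg]⟩
  exact V.exists_eq_constFun p fun N =>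
    ⟨l ^ N, Nat.lt_pow_self hl.one_lt, hpow N⟩
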